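/- Let $n\ge 0$ and let $X\in\mathbb{C}^{n\times n}$ have no eigenvalues on $(-\infty,0]$. A principal logarithm of $X$ is a matrix $L\in\mathbb{C}^{n\times n}$ with $e^{L}=X$ all of whose eigenvalues lie in the strip $\{z\in\mathbb{C}:-\pi<\operatorname{Im}z<\pi\}$. Then $X$ has exactly one principal logarithm $L$, and the following hold, where $\top$ denotes transpose and $\dagger$ conjugate transpose. 1. If $X$ is unitary, then $L^{\dagger}=-L$. 2. If $X$ is complex symmetric ($X^{\top}=X$), then $L$ is complex symmetric. 3. If all entries of $X$ are real, then all entries of $L$ are real. 4. Suppose $n=2m$ is even, let $Z=\begin{pmatrix}0&I_m\\-I_m&0\end{pmatrix}$, and put $Y^{\sharp}=-ZY^{\top}Z$ for $Y\in\mathbb{C}^{n\times n}$. If $X$ is self-dual ($X^{\sharp}=X$), then $L$ is self-dual ($L^{\sharp}=L$). 5. For every unitary $\Gamma\in\mathbb{C}^{n\times n}$ with $\Gamma^{2}=I$: if $\Gamma X\Gamma=X^{\dagger}$, then $\Gamma L\Gamma=L^{\dagger}$. -/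

import Mathlib

namespace MatrixLog

/-- `X` has no eigenvalue on the closed negative half-line `(-∞, 0]`. -/
def NoNonposEigenvalue {n : ℕ} (X : Matrix (Fin n) (Fin n) ℂ) : Prop :=
  ∀ x : ℝ, x ≤ 0 → ¬ Module.End.HasEigenvalue (Matrix.toLin' X) (x : ℂ)

/-- `L` is a principal logarithm of `X`: a logarithm, `e ^ L = X`, all of whose eigenvalues lie in
the open strip `-π < Im z < π`. -/
structure IsPrincipalLog {n : ℕ} (X L : Matrix (Fin n) (Fin n) ℂ) : Prop where
  exp_eq : NormedSpace.exp L = X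
  eigenvalue_im : ∀ z : ℂ, Module.End.HasEigenvalue (Matrix.toLin' L) z →
    -Real.pi < z.im ∧ z.im < Real.pi

/-- All entries of the complex matrix `X` are real. -/
def IsRealMatrix {n : ℕ} (X : Matrix (Fin n) (Fin n) ℂ) : Prop :=
  ∀ i j, (X i j).im = 0

/-- The `n × n` matrix with `m × m` blocks `[0, I; -I, 0]`, where `n = m + m`. -/
def Z {m n : ℕ} (h : m + m = n) : Matrix (Fin n) (Fin n) ℂ :=
  Matrix.reindex (finSumFinEquiv.trans (finCongr h)) (finSumFinEquiv.trans (finCongr h))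
    (Matrix.fromBlocks 0 1 (-1) 0)

/-- The dual operation `X ↦ -Z Xᵀ Z` on matrices of even size `n = m + m`. -/
def dual {m n : ℕ} (h : m + m = n) (X : Matrix (Fin n) (Fin n) ℂ) : Matrix (Fin n) (Fin n) ℂ :=
  -(Z h * X.transpose * Z h)

/-- `X` is self-dual: it equals its dual. -/
def IsSelfDual {m n : ℕ} (h : m + m = n) (X : Matrix (Fin n) (Fin n) ℂ) : Prop :=
  dual h X = X

end MatrixLog

/-! Existence: P = ∫₀¹ (X - 1)(1 + t(X - 1))⁻¹ dt exponentiates to X (`exp_integralLog`), and its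
eigenvalues are values of `Complex.log` on the slit plane, so they lie in the strip. Uniqueness: a
principal logarithm L commutes with X, hence with P, so exp(L - P) = 1. On a common eigenvector,
injectivity of exp on the strip makes the eigenvalue of L - P zero; a nilpotent matrix with
exponential 1 vanishes (`eq_zero_of_exp_eq_one`). Symmetries: transpose, adjoint, negation (with
inversion) and similarity carry principal logarithms to principal logarithms, so by uniqueness each
symmetry of X passes to L. -/

open Set

/-! ### The integral logarithm in a real Banach algebra -/

section BanachAlgebra

variable {A : Type*} [NormedRing A] [NormedAlgebra ℝ A]

/-- The integrand of the integral representation of the logarithm of `x`. -/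
noncomputable def logIntegrand (x : A) (t : ℝ) : A :=
  (x - 1) * Ring.inverse (1 + t • (x - 1))

theorem Commute.logIntegrand_left {x c : A} (h : Commute x c) (t : ℝ) :
    Commute (logIntegrand x t) c := by
  have h1 : Commute (x - 1) c := h.sub_left (Commute.one_left c)
  have h2 : Commute (1 + t • (x - 1)) c := (Commute.one_left c).add_left (h1.smul_left t)
  refine h1.mul_left ?_
  by_cases hu : IsUnit (1 + t • (x - 1))
  · obtain ⟨u, hu⟩ := hu
    rw [← hu] at h2 ⊢
    rw [Ring.inverse_unit]
    exact h2.units_inv_left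
  -- `Ring.inverse` is 0 off the units, so commutation needs no invertibility.
  · rw [Ring.inverse_non_unit _ hu]
    exact Commute.zero_left c

variable [CompleteSpace A]

/-- By commutation exp(f s) = exp(f t) exp(f s - f t), so only the derivative of exp at 0 is needed.
-/
theorem hasDerivAt_exp_of_commute {f : ℝ → A} {f' : A} {t : ℝ} (hf : HasDerivAt f f' t)
    (hc : ∀ s, Commute (f s) (f t)) :
    HasDerivAt (fun s => NormedSpace.exp (f s)) (NormedSpace.exp (f t) * f') t := by
  let _ : NormedAlgebra ℚ A := .restrictScalars ℚ ℝ A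
  have h1 : HasDerivAt (fun s => f s - f t) f' t := hf.sub_const _
  have h0 : HasFDerivAt NormedSpace.exp (1 : A →L[ℝ] A) (f t - f t) := by
    rw [sub_self]; exact hasFDerivAt_exp_zero
  have h2 : HasDerivAt (fun s => NormedSpace.exp (f s - f t)) f' t := by
    simpa [Function.comp_def] using h0.comp_hasDerivAt t h1
  refine (h2.const_mul (NormedSpace.exp (f t))).congr_of_eventuallyEq (.of_forall fun s => ?_)
  change NormedSpace.exp (f s) = NormedSpace.exp (f t) * NormedSpace.exp (f s - f t)
  rw [← NormedSpace.exp_add_of_commute (((hc s).symm).sub_right (Commute.refl _))]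
  simp

theorem Commute.intervalIntegral_left {g : ℝ → A} {c : A} (a b : ℝ)
    (h : ∀ t, Commute (g t) c) : Commute (∫ t in a..b, g t) c := by
  by_cases hg : IntervalIntegrable g MeasureTheory.volume a b
  · have h1 := (ContinuousLinearMap.mul ℝ A c).intervalIntegral_comp_comm hg
    have h2 := ((ContinuousLinearMap.mul ℝ A).flip c).intervalIntegral_comp_comm hg
    simp only [ContinuousLinearMap.mul_apply', ContinuousLinearMap.flip_apply] at h1 h2
    rw [Commute, SemiconjBy, ← h1, ← h2]
    exact intervalIntegral.integral_congr fun t _ => h t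
  · rw [intervalIntegral.integral_undef hg]
    exact Commute.zero_left c

theorem continuousAt_logIntegrand {x : A} {t : ℝ} (h : IsUnit (1 + t • (x - 1))) :
    ContinuousAt (logIntegrand x) t := by
  obtain ⟨u, hu⟩ := h
  have h1 := NormedRing.inverse_continuousAt u
  rw [hu] at h1
  have h2 : ContinuousAt (fun s : ℝ => 1 + s • (x - 1)) t := by fun_prop
  exact continuousAt_const.mul (ContinuousAt.comp (f := fun s : ℝ => 1 + s • (x - 1)) h1 h2)

theorem intervalIntegrable_logIntegrand {x : A} {b : ℝ} (hb : 0 ≤ b)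
    (h : ∀ t ∈ Icc (0 : ℝ) b, IsUnit (1 + t • (x - 1))) :
    IntervalIntegrable (logIntegrand x) MeasureTheory.volume 0 b := by
  refine ContinuousOn.intervalIntegrable fun t ht => ?_
  rw [uIcc_of_le hb] at ht
  exact (continuousAt_logIntegrand (h t ht)).continuousWithinAt

theorem hasDerivAt_integral_logIntegrand {x : A} {t : ℝ} (ht : 0 ≤ t)
    (h : ∀ s ∈ Icc (0 : ℝ) t, IsUnit (1 + s • (x - 1))) :
    HasDerivAt (fun s => ∫ r in (0 : ℝ)..s, logIntegrand x r) (logIntegrand x t) t := by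
  have hopen : IsOpen {s : ℝ | IsUnit (1 + s • (x - 1))} :=
    Units.isOpen.preimage (by fun_prop : Continuous fun s : ℝ => 1 + s • (x - 1))
  have htm : IsUnit (1 + t • (x - 1)) := h t ⟨ht, le_rfl⟩
  refine intervalIntegral.integral_hasDerivAt_right (intervalIntegrable_logIntegrand ht h) ?_
    (continuousAt_logIntegrand htm)
  exact ContinuousAt.stronglyMeasurableAtFilter hopen
    (fun s hs => continuousAt_logIntegrand hs) t htm

/-- The logarithm of `x` given by its integral representation. -/
noncomputable def integralLog (x : A) : A := ∫ t in (0 : ℝ)..1, logIntegrand x t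

theorem Commute.integralLog_left {x c : A} (h : Commute x c) : Commute (integralLog x) c :=
  Commute.intervalIntegral_left 0 1 h.logIntegrand_left

/-- With F the integral from 0 to s, exp(-F(s))(1 + s(x - 1)) has derivative zero; compare s = 0 and
s = 1. -/
theorem exp_integralLog {x : A} (h : ∀ t ∈ Icc (0 : ℝ) 1, IsUnit (1 + t • (x - 1))) :
    NormedSpace.exp (integralLog x) = x := by
  let _ : NormedAlgebra ℚ A := .restrictScalars ℚ ℝ A
  set F : ℝ → A := fun s => ∫ r in (0 : ℝ)..s, logIntegrand x r with hF
  have hcx : ∀ s, Commute x (F s) := fun s =>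
    (Commute.intervalIntegral_left 0 s ((Commute.refl x).logIntegrand_left)).symm
  have hFF : ∀ s t, Commute (F s) (F t) := fun s t =>
    Commute.intervalIntegral_left 0 s ((hcx t).logIntegrand_left)
  have hd : ∀ t ∈ Icc (0 : ℝ) 1,
      HasDerivAt (fun s => NormedSpace.exp (-F s) * (1 + s • (x - 1))) 0 t := by
    intro t ht
    have h1 : HasDerivAt F (logIntegrand x t) t :=
      hasDerivAt_integral_logIntegrand ht.1 fun s hs => h s ⟨hs.1, hs.2.trans ht.2⟩
    have h2 := hasDerivAt_exp_of_commute h1.neg fun s => (hFF s t).neg_left.neg_right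
    have h3 : HasDerivAt (fun s : ℝ => 1 + s • (x - 1)) (x - 1) t := by
      simpa using ((hasDerivAt_id t).smul_const (x - 1)).const_add 1
    have hinv : logIntegrand x t * (1 + t • (x - 1)) = x - 1 := by
      rw [logIntegrand, mul_assoc, Ring.inverse_mul_cancel _ (h t ht), mul_one]
    have h4 := h2.fun_mul h3
    rw [mul_assoc, neg_mul, hinv, mul_neg, neg_add_cancel] at h4
    exact h4
  have hconst := constant_of_has_deriv_right_zero
    (fun t ht => (hd t ht).continuousAt.continuousWithinAt)
    (fun t ht => (hd t ⟨ht.1, ht.2.le⟩).hasDerivWithinAt) 1 (right_mem_Icc.2 zero_le_one)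
  have hF0 : F 0 = 0 := by simp [hF]
  have hF1 : F 1 = integralLog x := rfl
  simp only [hF0, hF1, neg_zero, NormedSpace.exp_zero, zero_smul, add_zero, mul_one, one_smul,
    add_sub_cancel] at hconst
  calc NormedSpace.exp (integralLog x)
      = NormedSpace.exp (integralLog x) * (NormedSpace.exp (-integralLog x) * x) := by
        rw [hconst, mul_one]
    _ = x := by
        rw [← mul_assoc, ← NormedSpace.exp_add_of_commute (Commute.refl _).neg_right]
        simp

end BanachAlgebra

theorem Module.End.exists_eigenvector_mem {K V : Type*} [Field K] [IsAlgClosed K]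
    [AddCommGroup V] [Module K V] [FiniteDimensional K V] (f : Module.End K V)
    {p : Submodule K V} (hp : p ≠ ⊥) (hf : ∀ v ∈ p, f v ∈ p) :
    ∃ μ : K, ∃ v ∈ p, v ≠ 0 ∧ f v = μ • v := by
  have : Nontrivial p := Submodule.nontrivial_iff_ne_bot.2 hp
  obtain ⟨μ, hμ⟩ := Module.End.exists_eigenvalue (f.restrict hf)
  obtain ⟨v, hv⟩ := hμ.exists_hasEigenvector
  refine ⟨μ, v, v.2, fun h => hv.2 (Subtype.ext h), ?_⟩
  simpa using congrArg Subtype.val hv.apply_eq_smul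

theorem Module.End.HasEigenvalue.exists_common_eigenvector {K V : Type*} [Field K] [IsAlgClosed K]
    [AddCommGroup V] [Module K V] [FiniteDimensional K V] {f g : Module.End K V} {μ : K}
    (hμ : f.HasEigenvalue μ) (h : Commute f g) :
    ∃ ν : K, ∃ v, v ≠ 0 ∧ f v = μ • v ∧ g v = ν • v := by
  obtain ⟨ν, v, hv, hv0, hgv⟩ := Module.End.exists_eigenvector_mem g (p := f.eigenspace μ) hμ
    fun v hv => by
      rw [Module.End.mem_eigenspace_iff] at hv ⊢
      rw [← Module.End.mul_apply, h.eq, Module.End.mul_apply, hv, map_smul]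
  exact ⟨ν, v, hv0, Module.End.mem_eigenspace_iff.1 hv, hgv⟩

/-! ### Eigenvectors, exponentials and spectra of matrices -/

namespace Matrix

open scoped Matrix.Norms.Operator

variable {ι : Type*} [Fintype ι] [DecidableEq ι]

theorem hasEigenvalue_toLin'_iff {M : Matrix ι ι ℂ} {z : ℂ} :
    Module.End.HasEigenvalue (Matrix.toLin' M) z ↔ z ∈ spectrum ℂ M := by
  rw [Module.End.hasEigenvalue_iff_mem_spectrum, Matrix.spectrum_toLin']

theorem hasEigenvalue_toLin'_of_mulVec {M : Matrix ι ι ℂ} {z : ℂ} {v : ι → ℂ} (hv : v ≠ 0)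
    (h : M *ᵥ v = z • v) : Module.End.HasEigenvalue (Matrix.toLin' M) z :=
  Module.End.hasEigenvalue_of_hasEigenvector
    ⟨Module.End.mem_eigenspace_iff.2 (by rwa [Matrix.toLin'_apply]), hv⟩

theorem exists_common_eigenvector_of_commute {M N : Matrix ι ι ℂ} {z : ℂ}
    (hz : Module.End.HasEigenvalue (Matrix.toLin' M) z) (h : Commute M N) :
    ∃ w : ℂ, ∃ v, v ≠ 0 ∧ M *ᵥ v = z • v ∧ N *ᵥ v = w • v := by
  have hc : Commute (Matrix.toLin' M) (Matrix.toLin' N) := by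
    rw [Commute, SemiconjBy, Module.End.mul_eq_comp, Module.End.mul_eq_comp,
      ← Matrix.toLin'_mul, ← Matrix.toLin'_mul, h.eq]
  simpa only [Matrix.toLin'_apply] using hz.exists_common_eigenvector hc

theorem hasSum_exp_mulVec (M : Matrix ι ι ℂ) (v : ι → ℂ) :
    HasSum (fun k : ℕ => ((k.factorial : ℂ)⁻¹) • ((M ^ k) *ᵥ v)) (NormedSpace.exp M *ᵥ v) := by
  have h := NormedSpace.exp_series_hasSum_exp' (𝕂 := ℂ) M
  have hc : Continuous fun N : Matrix ι ι ℂ => N *ᵥ v := continuous_id.matrix_mulVec continuous_const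
  have := h.map (AddMonoidHom.mk' (fun N : Matrix ι ι ℂ => N *ᵥ v)
    fun a b => Matrix.add_mulVec a b v) hc
  have hk : (AddMonoidHom.mk' (fun N : Matrix ι ι ℂ => N *ᵥ v)
      fun a b => Matrix.add_mulVec a b v) ∘ (fun k : ℕ => ((k.factorial : ℂ)⁻¹) • M ^ k) =
      fun k : ℕ => ((k.factorial : ℂ)⁻¹) • ((M ^ k) *ᵥ v) :=
    funext fun k => Matrix.smul_mulVec _ _ _
  rw [← hk]
  exact this

theorem exp_mulVec_of_eigenvector {M : Matrix ι ι ℂ} {z : ℂ} {v : ι → ℂ} (h : M *ᵥ v = z • v) :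
    NormedSpace.exp M *ᵥ v = Complex.exp z • v := by
  have hk : ∀ k : ℕ, (M ^ k) *ᵥ v = z ^ k • v := by
    intro k
    induction k with
    | zero => simp
    | succ k ih =>
      rw [pow_succ, ← Matrix.mulVec_mulVec, h, Matrix.mulVec_smul, ih, smul_smul, pow_succ']
  have h1 := hasSum_exp_mulVec M v
  have h2 := (NormedSpace.exp_series_hasSum_exp' (𝕂 := ℂ) z).smul_const v
  rw [← Complex.exp_eq_exp_ℂ] at h2
  refine h1.unique ?_
  simpa [hk, smul_smul] using h2

theorem exp_mulVec_of_mulVec_mulVec_eq_zero {M : Matrix ι ι ℂ} {v : ι → ℂ}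
    (h : M *ᵥ (M *ᵥ v) = 0) : NormedSpace.exp M *ᵥ v = v + M *ᵥ v := by
  have h2 : HasSum (fun k : ℕ => ((k.factorial : ℂ)⁻¹) • ((M ^ k) *ᵥ v))
      (∑ k ∈ Finset.range 2, ((k.factorial : ℂ)⁻¹) • ((M ^ k) *ᵥ v)) := by
    refine hasSum_sum_of_ne_finset_zero fun k hk => ?_
    obtain ⟨j, rfl⟩ := Nat.exists_eq_add_of_le (not_lt.1 (Finset.mem_range.not.1 hk))
    rw [add_comm, pow_add, ← Matrix.mulVec_mulVec, pow_two, ← Matrix.mulVec_mulVec, h]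
    simp
  rw [(hasSum_exp_mulVec M v).unique h2]
  simp [Finset.sum_range_succ]

/-- If D ≠ 0, its range contains an eigenvector Dw, with eigenvalue 0. Then D²w = 0, the series
stops, and w = exp(D)w = w + Dw forces Dw = 0. -/
theorem eq_zero_of_exp_eq_one {D : Matrix ι ι ℂ} (h : NormedSpace.exp D = 1)
    (hD : ∀ z, Module.End.HasEigenvalue (Matrix.toLin' D) z → z = 0) : D = 0 := by
  by_contra h0
  have hr : LinearMap.range (Matrix.toLin' D) ≠ ⊥ := by
    rw [Ne, LinearMap.range_eq_bot]
    simpa using h0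
  obtain ⟨z, u, ⟨w, rfl⟩, hu0, hu⟩ := Module.End.exists_eigenvector_mem (Matrix.toLin' D) hr
    fun v _ => LinearMap.mem_range_self _ v
  simp only [Matrix.toLin'_apply] at hu hu0
  rw [hD z (hasEigenvalue_toLin'_of_mulVec hu0 hu), zero_smul] at hu
  have := exp_mulVec_of_mulVec_mulVec_eq_zero hu
  rw [h, Matrix.one_mulVec] at this
  exact hu0 (by simpa using this)

theorem logIntegrand_mulVec {X : Matrix ι ι ℂ} {x : ℂ} {v : ι → ℂ} {t : ℝ}
    (hv : v ≠ 0) (hX : X *ᵥ v = x • v) (ht : IsUnit (1 + t • (X - 1))) :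
    logIntegrand X t *ᵥ v = ((x - 1) * (1 + t • (x - 1))⁻¹) • v := by
  have h1 : (X - 1) *ᵥ v = (x - 1) • v := by
    rw [Matrix.sub_mulVec, hX, Matrix.one_mulVec, sub_smul, one_smul]
  have h2 : (1 + t • (X - 1)) *ᵥ v = (1 + t • (x - 1)) • v := by
    rw [Matrix.add_mulVec, Matrix.smul_mulVec, h1, Matrix.one_mulVec, add_smul, one_smul,
      smul_assoc]
  have h3 : v = (1 + t • (x - 1)) • (Ring.inverse (1 + t • (X - 1)) *ᵥ v) := by
    rw [← Matrix.mulVec_smul, ← h2, Matrix.mulVec_mulVec, Ring.inverse_mul_cancel _ ht,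
      Matrix.one_mulVec]
  have h4 : 1 + t • (x - 1) ≠ 0 := fun h => hv (by rw [h3, h, zero_smul])
  have h5 : Ring.inverse (1 + t • (X - 1)) *ᵥ v = (1 + t • (x - 1))⁻¹ • v := by
    conv_rhs => rw [h3, smul_smul, inv_mul_cancel₀ h4, one_smul]
  rw [logIntegrand, ← Matrix.mulVec_mulVec, h5, Matrix.mulVec_smul, h1, smul_smul, mul_comm]

theorem integralLog_mulVec {X : Matrix ι ι ℂ} {x : ℂ} {v : ι → ℂ} (hv : v ≠ 0)
    (hX : X *ᵥ v = x • v) (hx : x ∈ Complex.slitPlane)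
    (h : ∀ t ∈ Icc (0 : ℝ) 1, IsUnit (1 + t • (X - 1))) :
    integralLog X *ᵥ v = Complex.log x • v := by
  let e : Matrix ι ι ℂ →L[ℝ] (ι → ℂ) :=
    LinearMap.toContinuousLinearMap
      { toFun := fun N => N *ᵥ v
        map_add' := fun a b => Matrix.add_mulVec a b v
        map_smul' := fun a b => Matrix.smul_mulVec a b v }
  have h1 := e.intervalIntegral_comp_comm (intervalIntegrable_logIntegrand zero_le_one h)
  have h2 : Complex.log x = (x - 1) * ∫ t : ℝ in (0 : ℝ)..1, (1 + t • (x - 1))⁻¹ := by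
    simpa using Complex.log_eq_integral (z := x - 1) (by simpa using hx)
  refine h1.symm.trans ?_
  rw [h2, ← intervalIntegral.integral_const_mul, ← intervalIntegral.integral_smul_const]
  refine intervalIntegral.integral_congr fun t ht => ?_
  rw [uIcc_of_le zero_le_one] at ht
  exact logIntegrand_mulVec hv hX (h t ht)

theorem exp_commute_self (M : Matrix ι ι ℂ) : Commute M (NormedSpace.exp M) :=
  let _ : NormedAlgebra ℚ (Matrix ι ι ℂ) := .restrictScalars ℚ ℂ _
  (Commute.refl M).exp_right

theorem mem_spectrum_transpose {M : Matrix ι ι ℂ} {z : ℂ} :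
    z ∈ spectrum ℂ Mᵀ ↔ z ∈ spectrum ℂ M := by
  rw [Matrix.mem_spectrum_iff_isRoot_charpoly, Matrix.mem_spectrum_iff_isRoot_charpoly,
    Matrix.charpoly_transpose]

theorem mem_spectrum_conjTranspose {M : Matrix ι ι ℂ} {z : ℂ} :
    z ∈ spectrum ℂ Mᴴ ↔ star z ∈ spectrum ℂ M := by
  rw [← Matrix.star_eq_conjTranspose, spectrum.map_star, Set.mem_star]

end Matrix

/-! ### Existence, uniqueness and symmetries of the principal logarithm -/

namespace MatrixLog

open Matrix
open scoped Matrix.Norms.Operator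

variable {n : ℕ} {X L : Matrix (Fin n) (Fin n) ℂ}

theorem NoNonposEigenvalue.isUnit (hX : NoNonposEigenvalue X) {t : ℝ} (ht : t ∈ Icc (0 : ℝ) 1) :
    IsUnit (1 + t • (X - 1)) := by
  rcases ht.1.eq_or_lt with rfl | ht0
  · simp
  -- 1 + t(X - 1) = -t((1 - 1/t) - X), and 1 - 1/t ≤ 0 is not an eigenvalue.
  have h := hX (1 - t⁻¹) (sub_nonpos.2 ((one_le_inv₀ ht0).2 ht.2))
  rw [hasEigenvalue_toLin'_iff, spectrum.notMem_iff] at h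
  have htc : (t : ℂ) ≠ 0 := by exact_mod_cast ht0.ne'
  have h2 : (1 + t • (X - 1)) = (Units.mk0 (-(t : ℂ)) (neg_ne_zero.2 htc)) •
      (algebraMap ℂ (Matrix (Fin n) (Fin n) ℂ) ((1 - t⁻¹ : ℝ) : ℂ) - X) := by
    rw [Units.smul_mk0, Algebra.algebraMap_eq_smul_one, smul_sub (-(t : ℂ)), smul_smul]
    have : -(t : ℂ) * ((1 - t⁻¹ : ℝ) : ℂ) = 1 - t := by
      push_cast; field_simp; ring
    rw [this, ← Complex.coe_smul, smul_sub, sub_smul, neg_smul, one_smul]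
    abel
  rw [h2]
  exact h.smul _

theorem NoNonposEigenvalue.mem_slitPlane (hX : NoNonposEigenvalue X) {x : ℂ}
    (hx : Module.End.HasEigenvalue (Matrix.toLin' X) x) : x ∈ Complex.slitPlane := by
  by_contra h
  rw [Complex.mem_slitPlane_iff, not_or, not_lt, not_not] at h
  refine hX x.re h.1 ?_
  rwa [show (x.re : ℂ) = x from Complex.ext rfl h.2.symm]

theorem NoNonposEigenvalue.isPrincipalLog_integralLog (hX : NoNonposEigenvalue X) :
    IsPrincipalLog X (integralLog X) where
  exp_eq := exp_integralLog fun _ => hX.isUnit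
  eigenvalue_im z hz := by
    obtain ⟨x, v, hv0, hv, hxv⟩ := exists_common_eigenvector_of_commute hz
      (Commute.refl X).integralLog_left
    have hx := hX.mem_slitPlane (hasEigenvalue_toLin'_of_mulVec hv0 hxv)
    rw [integralLog_mulVec hv0 hxv hx fun _ => hX.isUnit] at hv
    rw [← smul_left_injective ℂ hv0 hv, Complex.log_im]
    exact ⟨Complex.neg_pi_lt_arg x,
      (Complex.arg_le_pi x).lt_of_ne (Complex.slitPlane_arg_ne_pi hx)⟩

theorem IsPrincipalLog.eq_integralLog (hX : NoNonposEigenvalue X) (hL : IsPrincipalLog X L) :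
    L = integralLog X := by
  have hP := hX.isPrincipalLog_integralLog
  have hXL : Commute X L := by
    have := exp_commute_self L
    rw [hL.exp_eq] at this
    exact this.symm
  have hc : Commute (integralLog X) L := hXL.integralLog_left
  rw [← sub_eq_zero]
  refine eq_zero_of_exp_eq_one ?_ fun d hd => ?_
  · rw [sub_eq_add_neg, Matrix.exp_add_of_commute _ _ hc.symm.neg_right, hL.exp_eq]
    have h := Matrix.exp_add_of_commute _ _ (Commute.refl (integralLog X)).neg_right
    rw [add_neg_cancel, NormedSpace.exp_zero, hP.exp_eq] at h
    exact h.symm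
  · obtain ⟨l, v, hv0, hdv, hlv⟩ := exists_common_eigenvector_of_commute hd
      ((Commute.refl L).sub_left hc)
    have hpv : integralLog X *ᵥ v = (l - d) • v := by
      rw [Matrix.sub_mulVec, hlv] at hdv
      rw [sub_smul, ← hdv, sub_sub_cancel]
    have h1 := exp_mulVec_of_eigenvector hlv
    have h2 := exp_mulVec_of_eigenvector hpv
    rw [hL.exp_eq] at h1
    rw [hP.exp_eq, h1] at h2
    have b1 := hL.eigenvalue_im _ (hasEigenvalue_toLin'_of_mulVec hv0 hlv)
    have b2 := hP.eigenvalue_im _ (hasEigenvalue_toLin'_of_mulVec hv0 hpv)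
    -- Both l and l - d lie in the strip and have the same exponential, so d = 0.
    have := Complex.exp_inj_of_neg_pi_lt_of_le_pi b1.1 b1.2.le b2.1 b2.2.le
      (smul_left_injective ℂ hv0 h2)
    linear_combination this

theorem IsPrincipalLog.unique {L' : Matrix (Fin n) (Fin n) ℂ} (hX : NoNonposEigenvalue X)
    (hL : IsPrincipalLog X L) (hL' : IsPrincipalLog X L') : L = L' :=
  (hL.eq_integralLog hX).trans (hL'.eq_integralLog hX).symm

theorem IsPrincipalLog.transpose (hL : IsPrincipalLog X L) : IsPrincipalLog Xᵀ Lᵀ where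
  exp_eq := by rw [Matrix.exp_transpose, hL.exp_eq]
  eigenvalue_im z hz := by
    rw [hasEigenvalue_toLin'_iff, mem_spectrum_transpose, ← hasEigenvalue_toLin'_iff] at hz
    exact hL.eigenvalue_im z hz

theorem IsPrincipalLog.conjTranspose (hL : IsPrincipalLog X L) : IsPrincipalLog Xᴴ Lᴴ where
  exp_eq := by rw [Matrix.exp_conjTranspose, hL.exp_eq]
  eigenvalue_im z hz := by
    rw [hasEigenvalue_toLin'_iff, mem_spectrum_conjTranspose, ← hasEigenvalue_toLin'_iff] at hz
    have := hL.eigenvalue_im _ hz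
    simp only [Complex.star_def, Complex.conj_im] at this
    constructor <;> linarith [this.1, this.2]

theorem IsPrincipalLog.inv (hL : IsPrincipalLog X L) : IsPrincipalLog X⁻¹ (-L) where
  exp_eq := by rw [Matrix.exp_neg, hL.exp_eq]
  eigenvalue_im z hz := by
    rw [hasEigenvalue_toLin'_iff, ← spectrum.neg_eq, Set.mem_neg, ← hasEigenvalue_toLin'_iff] at hz
    have := hL.eigenvalue_im _ hz
    rw [Complex.neg_im] at this
    constructor <;> linarith [this.1, this.2]

theorem IsPrincipalLog.conj_of_mul_eq_one {U V : Matrix (Fin n) (Fin n) ℂ}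
    (hL : IsPrincipalLog X L) (h : U * V = 1) : IsPrincipalLog (U * X * V) (U * L * V) where
  exp_eq := by
    rw [← hL.exp_eq]
    exact Matrix.exp_units_conj ⟨U, V, h, mul_eq_one_comm.1 h⟩ L
  eigenvalue_im z hz := by
    have hs : spectrum ℂ (U * L * V) = spectrum ℂ L :=
      spectrum.units_conjugate (u := ⟨U, V, h, mul_eq_one_comm.1 h⟩)
    rw [hasEigenvalue_toLin'_iff, hs, ← hasEigenvalue_toLin'_iff] at hz
    exact hL.eigenvalue_im z hz

theorem NoNonposEigenvalue.conjTranspose (hX : NoNonposEigenvalue X) : NoNonposEigenvalue Xᴴ := by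
  intro x hx h
  rw [hasEigenvalue_toLin'_iff, mem_spectrum_conjTranspose, ← hasEigenvalue_toLin'_iff,
    Complex.star_def, Complex.conj_ofReal] at h
  exact hX x hx h

theorem isRealMatrix_iff : IsRealMatrix X ↔ Xᴴᵀ = X := by
  simp only [IsRealMatrix, ← Matrix.ext_iff, Matrix.transpose_apply, Matrix.conjTranspose_apply,
    Complex.star_def, Complex.conj_eq_iff_im]

theorem Z_mul_Z {m : ℕ} (h : m + m = n) : Z h * Z h = -1 := by
  rw [Z, Matrix.reindex_apply, Matrix.submatrix_mul_equiv, Matrix.fromBlocks_multiply]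
  simp only [mul_zero, zero_mul, mul_one, one_mul, zero_add, add_zero]
  rw [show Matrix.fromBlocks (-1 : Matrix (Fin m) (Fin m) ℂ) 0 0 (-1) = -1 by
    rw [← Matrix.fromBlocks_one, Matrix.fromBlocks_neg]; simp]
  ext i j
  simp [Matrix.one_apply]

/-- As Z² = -1, -Z is the inverse of Z: the dual is a similarity applied to the transpose. -/
theorem dual_eq_conj {m : ℕ} (h : m + m = n) (Y : Matrix (Fin n) (Fin n) ℂ) :
    dual h Y = Z h * Yᵀ * -Z h :=
  (mul_neg _ _).symm

end MatrixLog
theorem mainTheorem5 {n : ℕ} (X : Matrix (Fin n) (Fin n) ℂ)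
    (hX : MatrixLog.NoNonposEigenvalue X) :
    (∃! L : Matrix (Fin n) (Fin n) ℂ, MatrixLog.IsPrincipalLog X L) ∧
    ∀ L : Matrix (Fin n) (Fin n) ℂ, MatrixLog.IsPrincipalLog X L →
      (X ∈ Matrix.unitaryGroup (Fin n) ℂ → L.conjTranspose = -L) ∧
      (X.IsSymm → L.IsSymm) ∧
      (MatrixLog.IsRealMatrix X → MatrixLog.IsRealMatrix L) ∧
      (∀ (m : ℕ) (hm : m + m = n), MatrixLog.IsSelfDual hm X → MatrixLog.IsSelfDual hm L) ∧
      (∀ Γ : Matrix (Fin n) (Fin n) ℂ, Γ ∈ Matrix.unitaryGroup (Fin n) ℂ → Γ * Γ = 1 →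
        Γ * X * Γ = X.conjTranspose → Γ * L * Γ = L.conjTranspose) := by
  refine ⟨⟨_, hX.isPrincipalLog_integralLog, fun L hL => hL.eq_integralLog hX⟩,
    fun L hL => ⟨fun hU => ?_, fun hS => ?_, fun hR => ?_, fun m hm hS => ?_,
      fun Γ _ hΓ hXΓ => ?_⟩⟩
  · have hinv : X.conjTranspose⁻¹ = X :=
      Matrix.inv_eq_right_inv (Matrix.mem_unitaryGroup_iff'.1 hU)
    have h := hL.conjTranspose.inv
    rw [hinv] at h
    exact neg_eq_iff_eq_neg.1 (h.unique hX hL)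
  · have h := hL.transpose
    rw [hS.eq] at h
    exact h.unique hX hL
  · rw [MatrixLog.isRealMatrix_iff] at hR ⊢
    have h := hL.conjTranspose.transpose
    rw [hR] at h
    exact h.unique hX hL
  · have h := hL.transpose.conj_of_mul_eq_one
      (by rw [mul_neg, MatrixLog.Z_mul_Z, neg_neg] : MatrixLog.Z hm * -MatrixLog.Z hm = 1)
    rw [← MatrixLog.dual_eq_conj, ← MatrixLog.dual_eq_conj, hS] at h
    exact h.unique hX hL
  · have h := hL.conj_of_mul_eq_one hΓ
    rw [hXΓ] at h
    -- Here both candidates are logarithms of `Xᴴ`, so uniqueness is used there.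
    exact h.unique hX.conjTranspose hL.conjTranspose
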